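/- Let $G$ be a finite group of order $m\ge 1$. For $n\ge 0$ let $Q_n(G)$ be the Dowling lattice of rank $n$ associated to $G$, that is, the poset of partial $G$-partitions of $[n]=\{1,\dots,n\}$. Equivalently, $Q_n(G)$ is the set, ordered by refinement, of all partitions of $\{0\}\cup([n]\times G)$ that are invariant under the action of $G$ given by $h\cdot 0=0$, $h\cdot(i,g)=(i,hg)$, and in which every block not containing $0$ contains at most one pair $(i,g)$ for each $i\in[n]$. For $0\le k\le n$ let $W_m(n,k)$ be the Whitney number of the second kind of $Q_n(G)$, indexed by corank: $W_m(n,k)$ is the number of elements of $Q_n(G)$ of corank $k$, i.e. of rank $n-k$. Put $$D_m(n;q)=\sum_{k=0}^n W_m(n,k)q^k,\qquad F_{m,1}(n;q)=\sum_{k=0}^n k!\,W_m(n,k)m^kq^k,\qquad F_{m,2}(n;q)=\sum_{k=0}^n k!\,W_m(n,k)q^k .$$ Then each of the three sequences $\{D_m(n;q)\}_{n\ge 0}$, $\{F_{m,1}(n;q)\}_{n\ge 0}$, $\{F_{m,2}(n;q)\}_{n\ge 0}$ is strongly $q$-log-convex, where a sequence $\{f_n(q)\}_{n\ge 0}$ of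 real polynomials is called strongly $q$-log-convex if for all $n\ge r\ge 1$ the polynomial $f_{r-1}(q)f_{n+1}(q)-f_r(q)f_n(q)$ has only nonnegative coefficients. -/

import Mathlib

open Polynomial

/-- Left translation by `h : G` on the `G`-set `{0} ∪ ([n] × G)`: it fixes the extra point `0`
(encoded as `none`) and sends `(i, g)` to `(i, h * g)`. -/
def dowlingTranslate {G : Type*} [Group G] {n : ℕ} (h : G) :
    Option (Fin n × G) → Option (Fin n × G) :=
  Option.map (fun p => (p.1, h * p.2))

/-- The Dowling lattice `Q_n(G)`.

An element is a partial `G`-partition of `[n]`: pairwise disjoint nonempty subsets `A_1, …, A_k` of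
`[n]`, each with a labelling `a_j : A_j → G` that is taken up to left multiplication by an element
of `G`; the elements of `[n]` outside the `A_j` form the zero block. It is encoded without choosing
representatives, as an equivalence relation on `{0} ∪ ([n] × G)`: the class of `0` consists of `0`
and all `(i, g)` with `i` in the zero block, and the other classes are the graphs of all the
labellings `g * a_j`. The relations that arise in this way are those which are invariant under left
translation and in which every class not containing `0` is the graph of a partial function, that is,
contains at most one pair `(i, g)` for each `i`. -/
def DowlingLattice (G : Type*) [Group G] (n : ℕ) : Type _ :=
  {s : Setoid (Option (Fin n × G)) //
    (∀ (h : G) (x y : Option (Fin n × G)),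
      s x y → s (dowlingTranslate h x) (dowlingTranslate h y)) ∧
    (∀ (i : Fin n) (g g' : G),
      s (some (i, g)) (some (i, g')) → g ≠ g' → s (some (i, g)) none)}

/-- The order of the Dowling lattice is refinement: `α ≤ β` if every class of `α` is contained in
a class of `β`. So every labelled block of `β` is glued together from translates of labelled blocks
of `α`, and the remaining blocks of `α` are absorbed in the zero block of `β`. -/
instance DowlingLattice.instPartialOrder (G : Type*) [Group G] (n : ℕ) :
    PartialOrder (DowlingLattice G n) :=
  Subtype.partialOrder _

/-- The Whitney number of the second kind `W_m(n, k)` of `Q_n(G)`, where `m` is the order of `G`, in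
the usual indexing for Dowling lattices: the number of elements of corank `k` (equivalently, of
rank `n - k`). The corank of `x` is the length of a longest chain from `x` up to the top. -/
noncomputable def dowlingWhitney (G : Type*) [Group G] (n k : ℕ) : ℕ :=
  Nat.card {x : DowlingLattice G n // Order.coheight x = (k : ℕ∞)}

/-- The Dowling polynomial `D_m(n; q)`, `m = |G|`. -/
noncomputable def dowlingPoly (G : Type*) [Group G] (n : ℕ) : ℝ[X] :=
  ∑ k ∈ Finset.range (n + 1), C (dowlingWhitney G n k : ℝ) * X ^ k

/-- The polynomial `F_{m,1}(n; q)`, `m = |G|`. -/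
noncomputable def dowlingF₁ (G : Type*) [Group G] (n : ℕ) : ℝ[X] :=
  ∑ k ∈ Finset.range (n + 1),
    C ((k.factorial : ℝ) * (dowlingWhitney G n k : ℝ) * (Nat.card G : ℝ) ^ k) * X ^ k

/-- The polynomial `F_{m,2}(n; q)`, `m = |G|`. -/
noncomputable def dowlingF₂ (G : Type*) [Group G] (n : ℕ) : ℝ[X] :=
  ∑ k ∈ Finset.range (n + 1),
    C ((k.factorial : ℝ) * (dowlingWhitney G n k : ℝ)) * X ^ k

/-- A sequence of real polynomials is strongly `q`-log-convex if
`f_{m-1} f_{n+1} - f_m f_n` has nonnegative coefficients for all `n ≥ m ≥ 1`. -/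
def StronglyQLogConvex (f : ℕ → ℝ[X]) : Prop :=
  ∀ m n : ℕ, 1 ≤ m → m ≤ n → ∀ i : ℕ, 0 ≤ (f (m - 1) * f (n + 1) - f m * f n).coeff i

/-! Extending a partial `G`-partition by one index means letting `(n + 1, 1)` join one of the
existing classes or start a new block. An element of corank `k` has `1 + m k` classes, so `W(n+1,
k+1) = (1 + m (k+1)) W(n, k+1) + W(n, k)` (`extend_bijective`, `coheight_eq_iff`,
`card_numClasses_succ`). After multiplication by weights with `w (k+1) = (c + d (k+1)) w k`, all
three families have coefficients in an affine triangle.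

For such a triangle `f (n+1) = (a + (c+d) X) f n + (b + d X) X (f n)'`. In `f r * f (n+1) - f (r+1)
* f n` the first term cancels, leaving `b + d X` times the Wronskian of `f r` and `f n` for `X
d/dX`. Its coefficients are nonnegative because the triangle is totally positive of order two
(`minor_nonneg`), which follows from log-concavity of the rows. -/

/-! ### Affine triangles and total positivity of order two. -/

/-- A triangular array with nonnegative affine weights: the entry `(n, k)` is passed to `(n + 1, k)`
with weight `a + b k` and to `(n + 1, k + 1)` with weight `c + d (k + 1)`. -/
structure IsAffineTriangle (a b c d : ℝ) (T : ℕ → ℕ → ℝ) : Prop where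
  a_pos : 0 < a
  b_nonneg : 0 ≤ b
  c_nonneg : 0 ≤ c
  d_nonneg : 0 ≤ d
  cd_pos : 0 < c + d
  zero_zero : 0 < T 0 0
  zero_succ : ∀ k, T 0 (k + 1) = 0
  succ_zero : ∀ n, T (n + 1) 0 = a * T n 0
  succ_succ : ∀ n k, T (n + 1) (k + 1) =
    (a + b * (k + 1)) * T n (k + 1) + (c + d * (k + 1)) * T n k

namespace IsAffineTriangle

variable {a b c d : ℝ} {T : ℕ → ℕ → ℝ}

theorem eq_zero_of_lt (h : IsAffineTriangle a b c d T) {n k : ℕ} (hk : n < k) : T n k = 0 := by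
  induction n generalizing k with
  | zero =>
    obtain ⟨k, rfl⟩ := Nat.exists_eq_add_of_lt hk
    exact h.zero_succ _
  | succ n ih =>
    obtain ⟨k, rfl⟩ : ∃ l, k = l + 1 := ⟨k - 1, by omega⟩
    rw [h.succ_succ, ih (by omega), ih (by omega)]
    ring

theorem nonneg (h : IsAffineTriangle a b c d T) (n k : ℕ) : 0 ≤ T n k := by
  have := h.a_pos
  have := h.b_nonneg
  have := h.c_nonneg
  have := h.d_nonneg
  induction n generalizing k with
  | zero =>
    cases k with
    | zero => exact h.zero_zero.le
    | succ k => exact (h.zero_succ k).ge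
  | succ n ih =>
    cases k with
    | zero => rw [h.succ_zero]; exact mul_nonneg h.a_pos.le (ih 0)
    | succ k =>
      rw [h.succ_succ]
      exact add_nonneg (mul_nonneg (by positivity) (ih _)) (mul_nonneg (by positivity) (ih _))

theorem pos (h : IsAffineTriangle a b c d T) {n k : ℕ} (hk : k ≤ n) : 0 < T n k := by
  have := h.a_pos
  have := h.b_nonneg
  have := h.c_nonneg
  have hd := h.d_nonneg
  have := h.cd_pos
  induction n generalizing k with
  | zero =>
    obtain rfl : k = 0 := by omega
    exact h.zero_zero
  | succ n ih =>
    cases k with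
    | zero => rw [h.succ_zero]; exact mul_pos h.a_pos (ih (Nat.zero_le _))
    | succ k =>
      rw [h.succ_succ]
      have hw : 0 < c + d * (k + 1) := by
        have : 0 ≤ d * k := by positivity
        linarith
      exact add_pos_of_nonneg_of_pos (mul_nonneg (by positivity) (h.nonneg _ _))
        (mul_pos hw (ih (by omega)))

/-- The form with separated indices `i ≤ j` is what makes the induction close: expanding row `n + 1`
produces products of entries that are not adjacent. -/
theorem logConcave (h : IsAffineTriangle a b c d T) (n : ℕ) {i j : ℕ} (hij : i ≤ j) :
    T n i * T n (j + 1) ≤ T n (i + 1) * T n j := by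
  have ha := h.a_pos
  have hb := h.b_nonneg
  have hc := h.c_nonneg
  have hd := h.d_nonneg
  induction n generalizing i j with
  | zero =>
    rw [h.zero_succ, mul_zero]
    exact mul_nonneg (h.nonneg _ _) (h.nonneg _ _)
  | succ n ih =>
    obtain rfl | hij := hij.eq_or_lt
    · rw [mul_comm]
    obtain ⟨j, rfl⟩ : ∃ l, j = l + 1 := ⟨j - 1, by omega⟩
    have hij' : i ≤ j := by omega
    have hij'' : (0 : ℝ) ≤ j - i := by
      have : (i : ℝ) ≤ j := by exact_mod_cast hij'
      linarith
    have hxy : T n i * T n (j + 1) ≤ T n (i + 1) * T n j := ih hij'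
    have hsame : T n i * T n (j + 1 + 1) ≤ T n (i + 1) * T n (j + 1) := ih (by omega)
    have hn := h.nonneg n
    have hpi : 0 ≤ T n (i + 1) * T n (j + 1) := mul_nonneg (hn _) (hn _)
    have hi : (0 : ℝ) ≤ i := Nat.cast_nonneg i
    have hj : (0 : ℝ) ≤ j := Nat.cast_nonneg j
    -- Matching the expanded products by the induction hypothesis leaves surplus coefficients `b²`,
    -- `2bd` and `d²`, each times `j + 1 - i`, with all other cross terms cancelling.
    have hbb : 0 ≤ b * b * (j + 1 - i) := by
      refine mul_nonneg (mul_nonneg hb hb) (by linarith)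
    have h1 := mul_le_mul_of_nonneg_left hsame
      (by positivity : 0 ≤ (a + b * i) * (a + b * (j + 1 + 1)))
    have h1' : 0 ≤ (b * b * (j + 1 - i)) * (T n (i + 1) * T n (j + 1)) := mul_nonneg hbb hpi
    have h2 := mul_le_mul_of_nonneg_left hxy
      (by positivity : 0 ≤ (a + b * (i + 1)) * (c + d * (j + 1)))
    have hyn : 0 ≤ T n i * T n (j + 1) := mul_nonneg (hn _) (hn _)
    have hin : 0 ≤ T n i * T n j := mul_nonneg (hn _) (hn _)
    have hbd : 0 ≤ (2 * b * d * (j + 1 - i)) * (T n i * T n (j + 1)) :=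
      mul_nonneg (mul_nonneg (by positivity) (by linarith)) hyn
    cases i with
    | zero =>
      rw [h.succ_zero, h.succ_succ, h.succ_succ, h.succ_succ]
      push_cast at *
      have e1 : 0 ≤ (c + d) * (c + d * (j + 1)) * (T n 0 * T n j) :=
        mul_nonneg (by positivity) hin
      have e2 : 0 ≤ (c * (a + b * (j + 2))) * (T n 0 * T n (j + 1)) :=
        mul_nonneg (by positivity) hyn
      nlinarith
    | succ i =>
      rw [h.succ_succ, h.succ_succ, h.succ_succ, h.succ_succ]
      push_cast at *
      have hyz : T n i * T n (j + 1 + 1) ≤ T n (i + 1) * T n (j + 1) := ih (by omega)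
      have h3 := mul_le_mul_of_nonneg_left hyz
        (by positivity : 0 ≤ (c + d * (i + 1)) * (a + b * (j + 1 + 1)))
      have hcc : T n i * T n (j + 1) ≤ T n (i + 1) * T n j := ih (by omega)
      have h4 := mul_le_mul_of_nonneg_left hcc
        (by positivity : 0 ≤ (c + d * (i + 1)) * (c + d * (j + 1 + 1)))
      have h4' : 0 ≤ (d * d * (j + 1 - (i + 1))) * (T n (i + 1) * T n j) :=
        mul_nonneg (mul_nonneg (mul_nonneg hd hd) (by linarith)) hin
      nlinarith

/-- In the expansion the weights `a + b k` increase with `k`, and the terms with weights `c + d k`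
are compared by log-concavity of row `n`. -/
theorem minor_succ_nonneg (h : IsAffineTriangle a b c d T) (n : ℕ) {i j : ℕ} (hij : i ≤ j) :
    T n j * T (n + 1) i ≤ T n i * T (n + 1) j := by
  have ha := h.a_pos
  have hb := h.b_nonneg
  have hc := h.c_nonneg
  have hd := h.d_nonneg
  have hn := h.nonneg n
  obtain rfl | hij := hij.eq_or_lt
  · exact le_rfl
  obtain ⟨j, rfl⟩ : ∃ l, j = l + 1 := ⟨j - 1, by omega⟩
  have hij' : (i : ℝ) ≤ j := by exact_mod_cast (by omega : i ≤ j)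
  have h1 : 0 ≤ b * (j + 1 - i) * (T n i * T n (j + 1)) :=
    mul_nonneg (mul_nonneg hb (by linarith)) (mul_nonneg (hn _) (hn _))
  have h2 : 0 ≤ T n i * T n j := mul_nonneg (hn _) (hn _)
  cases i with
  | zero =>
    rw [h.succ_zero, h.succ_succ]
    have h3 : 0 ≤ (c + d * (j + 1)) * (T n 0 * T n j) := mul_nonneg (by positivity) h2
    push_cast at *
    linarith
  | succ i =>
    rw [h.succ_succ, h.succ_succ]
    have h3 := mul_le_mul_of_nonneg_left (h.logConcave n (by omega : i ≤ j))
      (by positivity : 0 ≤ c + d * (i + 1))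
    push_cast at *
    have h4 : 0 ≤ d * (j - i) * (T n (i + 1) * T n j) :=
      mul_nonneg (mul_nonneg hd (by linarith)) h2
    linarith

/-- The array is totally positive of order two. -/
theorem minor_nonneg (h : IsAffineTriangle a b c d T) {r n : ℕ} (hrn : r ≤ n) {i j : ℕ}
    (hij : i ≤ j) : T r j * T n i ≤ T r i * T n j := by
  induction n, hrn using Nat.le_induction with
  | base => rw [mul_comm]
  | succ n hrn ih =>
    by_cases hj : r < j
    · rw [h.eq_zero_of_lt hj, zero_mul]
      exact mul_nonneg (h.nonneg _ _) (h.nonneg _ _)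
    -- Here `i ≤ j ≤ r ≤ n`, so the pivot `T n i` can be cancelled when the minors for `r, n` and
    -- `n, n + 1` are chained.
    have hi : 0 < T n i := h.pos (by omega)
    have hs := h.minor_succ_nonneg n hij
    refine le_of_mul_le_mul_left ?_ hi
    calc T n i * (T r j * T (n + 1) i) = (T r j * T n i) * T (n + 1) i := by ring
      _ ≤ (T r i * T n j) * T (n + 1) i := mul_le_mul_of_nonneg_right ih (h.nonneg _ _)
      _ = T r i * (T n j * T (n + 1) i) := by ring
      _ ≤ T r i * (T n i * T (n + 1) j) := mul_le_mul_of_nonneg_left hs (h.nonneg _ _)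
      _ = T n i * (T r i * T (n + 1) j) := by ring

end IsAffineTriangle

/-! ### Wronskians and strong `q`-log-convexity. -/

theorem coeff_X_mul_derivative (f : ℝ[X]) (k : ℕ) :
    (X * derivative f).coeff k = k * f.coeff k := by
  cases k with
  | zero => simp
  | succ k => rw [coeff_X_mul, coeff_derivative]; push_cast; ring

/-- Averaging the convolution sum with its swap pairs each factor `p.2 - p.1` with a 2×2 minor of
the same sign. -/
theorem coeff_wronskian_nonneg {f g : ℝ[X]}
    (h : ∀ i j, i ≤ j → f.coeff j * g.coeff i ≤ f.coeff i * g.coeff j) (k : ℕ) :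
    0 ≤ (f * (X * derivative g) - (X * derivative f) * g).coeff k := by
  have e : (f * (X * derivative g) - (X * derivative f) * g).coeff k =
      ∑ p ∈ Finset.HasAntidiagonal.antidiagonal k, ((p.2 : ℝ) - p.1) * (f.coeff p.1 * g.coeff p.2) := by
    rw [coeff_sub, coeff_mul, coeff_mul, ← Finset.sum_sub_distrib]
    refine Finset.sum_congr rfl fun p _ => ?_
    rw [coeff_X_mul_derivative, coeff_X_mul_derivative]
    ring
  have e' := e
  rw [← Finset.Nat.sum_antidiagonal_swap] at e'
  have e2 : 2 * (f * (X * derivative g) - (X * derivative f) * g).coeff k =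
      ∑ p ∈ Finset.HasAntidiagonal.antidiagonal k,
        ((p.2 : ℝ) - p.1) * (f.coeff p.1 * g.coeff p.2 - f.coeff p.2 * g.coeff p.1) := by
    rw [two_mul]
    nth_rw 1 [e]
    rw [e', ← Finset.sum_add_distrib]
    refine Finset.sum_congr rfl fun p _ => ?_
    simp only [Prod.fst_swap, Prod.snd_swap]
    ring
  have : 0 ≤ ∑ p ∈ Finset.HasAntidiagonal.antidiagonal k,
        ((p.2 : ℝ) - p.1) * (f.coeff p.1 * g.coeff p.2 - f.coeff p.2 * g.coeff p.1) := by
    refine Finset.sum_nonneg fun p _ => ?_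
    obtain hp | hp := le_total p.1 p.2
    · have := h _ _ hp
      exact mul_nonneg (sub_nonneg.2 (by exact_mod_cast hp)) (by linarith)
    · have := h _ _ hp
      exact mul_nonneg_of_nonpos_of_nonpos (sub_nonpos.2 (by exact_mod_cast hp)) (by linarith)
  linarith

theorem IsAffineTriangle.stronglyQLogConvex {a b c d : ℝ} {T : ℕ → ℕ → ℝ}
    (h : IsAffineTriangle a b c d T) {f : ℕ → ℝ[X]} (hf : ∀ n k, (f n).coeff k = T n k) :
    StronglyQLogConvex f := by
  have hrec : ∀ n, f (n + 1) = (C a + C (c + d) * X) * f n +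
      (C b + C d * X) * (X * derivative (f n)) := by
    intro n
    ext k
    rw [add_mul, add_mul, mul_assoc, mul_assoc, coeff_add, coeff_add, coeff_add, coeff_C_mul,
      coeff_C_mul, coeff_C_mul, coeff_C_mul, coeff_X_mul_derivative]
    cases k with
    | zero => simp [hf, h.succ_zero]
    | succ k =>
      rw [coeff_X_mul, coeff_X_mul, coeff_X_mul_derivative, hf, hf, hf, h.succ_succ]
      push_cast
      ring
  intro m n hm hmn i
  obtain ⟨r, rfl⟩ : ∃ r, m = r + 1 := ⟨m - 1, by omega⟩
  rw [Nat.add_sub_cancel]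
  have key : f r * f (n + 1) - f (r + 1) * f n =
      C b * (f r * (X * derivative (f n)) - (X * derivative (f r)) * f n) +
      C d * (X * (f r * (X * derivative (f n)) - (X * derivative (f r)) * f n)) := by
    rw [hrec n, hrec r]
    ring
  have hw := coeff_wronskian_nonneg (f := f r) (g := f n) fun i j hij => by
    simpa only [hf] using h.minor_nonneg (by omega : r ≤ n) hij
  rw [key, coeff_add, coeff_C_mul, coeff_C_mul]
  refine add_nonneg (mul_nonneg h.b_nonneg (hw i)) (mul_nonneg h.d_nonneg ?_)
  cases i with
  | zero => rw [coeff_X_mul_zero]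
  | succ i => rw [coeff_X_mul]; exact hw i

/-! ### Classes of an element and the action of `G` on them. -/

section Translate

variable {G : Type*} [Group G] {n : ℕ}

@[simp]
theorem dowlingTranslate_none (h : G) : dowlingTranslate h (none : Option (Fin n × G)) = none :=
  rfl

@[simp]
theorem dowlingTranslate_some (h : G) (i : Fin n) (g : G) :
    dowlingTranslate h (some (i, g)) = some (i, h * g) :=
  rfl

theorem dowlingTranslate_one (p : Option (Fin n × G)) : dowlingTranslate 1 p = p := by
  rcases p with _ | ⟨i, g⟩ <;> simp

theorem dowlingTranslate_mul (h k : G) (p : Option (Fin n × G)) :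
    dowlingTranslate (h * k) p = dowlingTranslate h (dowlingTranslate k p) := by
  rcases p with _ | ⟨i, g⟩ <;> simp [mul_assoc]

end Translate

namespace DowlingLattice

variable {G : Type*} [Group G] {n : ℕ}

instance [Finite G] : Finite (DowlingLattice G n) := by
  have : Finite (Setoid (Option (Fin n × G))) :=
    Finite.of_injective (fun s : Setoid (Option (Fin n × G)) => (s : _ → _ → Prop))
      fun s t hst => Setoid.ext fun x y => by
        have := congrFun (congrFun hst x) y
        exact Iff.of_eq this
  exact Subtype.finite

@[ext]
theorem ext {x y : DowlingLattice G n} (h : ∀ p q, x.1 p q ↔ y.1 p q) : x = y :=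
  Subtype.ext (Setoid.ext h)

theorem rel_translate (x : DowlingLattice G n) (h : G) {p q : Option (Fin n × G)}
    (hpq : x.1 p q) : x.1 (dowlingTranslate h p) (dowlingTranslate h q) :=
  x.2.1 h p q hpq

/-- The classes of the relation: the zero block and the translates of the labelled blocks. -/
abbrev Class (x : DowlingLattice G n) : Type _ := Quotient x.1

/-- The class of a point. -/
abbrev mk (x : DowlingLattice G n) (p : Option (Fin n × G)) : x.Class := Quotient.mk x.1 p

theorem mk_eq_mk {x : DowlingLattice G n} {p q : Option (Fin n × G)} :
    x.mk p = x.mk q ↔ x.1 p q :=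
  Quotient.eq

instance (x : DowlingLattice G n) : MulAction G x.Class where
  smul h := Quotient.map (dowlingTranslate h) fun _ _ => x.rel_translate h
  one_smul := by
    rintro ⟨p⟩
    exact congrArg x.mk (dowlingTranslate_one p)
  mul_smul h k := by
    rintro ⟨p⟩
    exact congrArg x.mk (dowlingTranslate_mul h k p)

theorem smul_mk (x : DowlingLattice G n) (h : G) (p : Option (Fin n × G)) :
    h • x.mk p = x.mk (dowlingTranslate h p) :=
  rfl

theorem smul_mk_none (x : DowlingLattice G n) (h : G) : h • x.mk none = x.mk none :=
  rfl

theorem mk_eq_mk_none_of_ne (x : DowlingLattice G n) {i : Fin n} {g g' : G}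
    (h : x.mk (some (i, g)) = x.mk (some (i, g'))) (hg : g ≠ g') :
    x.mk (some (i, g)) = x.mk none :=
  mk_eq_mk.2 (x.2.2 i g g' (mk_eq_mk.1 h) hg)

/-- The group acts freely on the classes other than the zero block. -/
theorem eq_mk_none_of_smul_eq_smul (x : DowlingLattice G n) {q : x.Class} {g g' : G}
    (h : g • q = g' • q) (hg : g ≠ g') : q = x.mk none := by
  obtain ⟨p, rfl⟩ := Quotient.exists_rep q
  obtain _ | ⟨i, k⟩ := p
  · rfl
  · have := x.mk_eq_mk_none_of_ne (i := i) (g := g * k) (g' := g' * k) h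
      (fun e => hg (mul_right_cancel e))
    have h2 := congrArg (g⁻¹ • ·) (show g • x.mk (some (i, k)) = x.mk none from this)
    simpa only [inv_smul_smul, smul_mk_none] using h2

/-- The number of classes. -/
noncomputable def numClasses (x : DowlingLattice G n) : ℕ := Nat.card x.Class

/-- The fibres of an equivariant map that separates the points `(i, g)` over the same `i`, except
for those in the fibre of `0`, form an element of the Dowling lattice. -/
def ofMap {β : Type*} [SMul G β] (φ : Option (Fin n × G) → β)
    (hφ : ∀ (h : G) p, φ (dowlingTranslate h p) = h • φ p)
    (hφ' : ∀ i g g', φ (some (i, g)) = φ (some (i, g')) → g ≠ g' → φ (some (i, g)) = φ none) :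
    DowlingLattice G n :=
  ⟨Setoid.ker φ, fun h p q hpq => by
    rw [Setoid.ker_def] at hpq ⊢
    rw [hφ, hφ, hpq], hφ'⟩

theorem numClasses_ofMap {β : Type*} [SMul G β] {φ : Option (Fin n × G) → β}
    (hφ : ∀ (h : G) p, φ (dowlingTranslate h p) = h • φ p)
    (hφ' : ∀ i g g', φ (some (i, g)) = φ (some (i, g')) → g ≠ g' → φ (some (i, g)) = φ none) :
    (ofMap φ hφ hφ').numClasses = Nat.card (Set.range φ) :=
  Nat.card_congr (Setoid.quotientKerEquivRange φ)

variable [Finite G]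

instance (x : DowlingLattice G n) : Finite x.Class := Quotient.finite _

theorem numClasses_pos (x : DowlingLattice G n) : 0 < x.numClasses := by
  have : Nonempty x.Class := ⟨x.mk none⟩
  exact Nat.card_pos

/-- Coarsening induces a surjection on classes; equal finite cardinalities would make it injective,
so `y ≤ x`. -/
theorem numClasses_lt_of_lt {x y : DowlingLattice G n} (hxy : x < y) :
    y.numClasses < x.numClasses := by
  have hle : ∀ p q, x.1 p q → y.1 p q := fun p q h => hxy.le h
  let f : x.Class → y.Class := Quotient.map id hle
  have hf : Function.Surjective f := by
    rintro ⟨p⟩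
    exact ⟨x.mk p, rfl⟩
  refine lt_of_le_of_ne (Nat.card_le_card_of_surjective f hf) fun hcard => hxy.not_ge ?_
  have hbij : Function.Bijective f :=
    (Nat.bijective_iff_surjective_and_card f).2 ⟨hf, hcard.symm⟩
  intro p q hpq
  exact mk_eq_mk.1 (hbij.1 (show y.mk p = y.mk q from mk_eq_mk.2 hpq))

/-- Absorbing a block into the zero block. -/
theorem exists_gt_numClasses_le (x : DowlingLattice G n) (hx : 1 < x.numClasses) :
    ∃ y, x < y ∧ x.numClasses ≤ y.numClasses + Nat.card G := by
  classical
  have : Nontrivial x.Class := Finite.one_lt_card_iff_nontrivial.1 hx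
  obtain ⟨q, hq⟩ := exists_ne (x.mk none)
  -- The orbit of `q` consists of all translates of one labelled block, so collapsing it to the zero
  -- class is equivariant.
  let ψ : x.Class → x.Class := fun c => if c ∈ MulAction.orbit G q then x.mk none else c
  have horb : ∀ (h : G) c, h • c ∈ MulAction.orbit G q ↔ c ∈ MulAction.orbit G q := fun h c => by
    rw [← MulAction.orbit_eq_iff, MulAction.orbit_smul, MulAction.orbit_eq_iff]
  have hψ : ∀ (h : G) c, ψ (h • c) = h • ψ c := by
    intro h c
    by_cases hc : c ∈ MulAction.orbit G q
    · simp only [ψ, if_pos hc, if_pos ((horb h c).2 hc)]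
      rfl
    · simp only [ψ, if_neg hc, if_neg (fun h' => hc ((horb h c).1 h'))]
  have h0 : x.mk none ∉ MulAction.orbit G q := by
    rintro ⟨g, hg⟩
    refine hq ?_
    have := congrArg (g⁻¹ • ·) hg
    simpa only [inv_smul_smul, smul_mk_none] using this
  have hψ0 : ψ (x.mk none) = x.mk none := by simp only [ψ, if_neg h0]
  have hψ' : ∀ i g g', ψ (x.mk (some (i, g))) = ψ (x.mk (some (i, g'))) → g ≠ g' →
      ψ (x.mk (some (i, g))) = ψ (x.mk none) := by
    intro i g g' h hg
    rw [hψ0]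
    have e : ∀ k : G, x.mk (some (i, k)) = k • x.mk (some (i, 1)) := fun k => by
      rw [smul_mk, dowlingTranslate_some, mul_one]
    rw [e g, e g', hψ, hψ] at h
    rw [e g, hψ, x.eq_mk_none_of_smul_eq_smul h hg, smul_mk_none]
  have hφ : ∀ (h : G) p, ψ (x.mk (dowlingTranslate h p)) = h • ψ (x.mk p) :=
    fun h p => hψ h (x.mk p)
  let y : DowlingLattice G n := ofMap (fun p => ψ (x.mk p)) hφ hψ'
  have hle : x ≤ y := fun p p' h => congrArg ψ (mk_eq_mk.2 h)
  refine ⟨y, lt_of_le_not_ge hle fun hyx => ?_, ?_⟩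
  · obtain ⟨p, rfl⟩ := Quotient.exists_rep q
    refine hq (mk_eq_mk.2 (hyx ?_))
    show ψ (x.mk p) = ψ (x.mk none)
    rw [hψ0]
    exact if_pos (MulAction.mem_orbit_self _)
  · have hy : y.numClasses = Nat.card (Set.range fun p => ψ (x.mk p)) := numClasses_ofMap hφ hψ'
    rw [hy, Nat.card_coe_set_eq]
    -- Only classes in the orbit are lost, and an orbit has at most `|G|` elements.
    have hcov : Set.univ ⊆ (Set.range fun p => ψ (x.mk p)) ∪ MulAction.orbit G q := by
      rintro c -
      by_cases hc : c ∈ MulAction.orbit G q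
      · exact Or.inr hc
      · obtain ⟨p, rfl⟩ := Quotient.exists_rep c
        exact Or.inl ⟨p, if_neg hc⟩
    calc x.numClasses = (Set.univ : Set x.Class).ncard := (Set.ncard_univ _).symm
      _ ≤ _ := Set.ncard_le_ncard hcov
      _ ≤ _ := Set.ncard_union_le _ _
      _ ≤ _ := Nat.add_le_add_left ?_ _
    rw [← Nat.card_coe_set_eq]
    exact Nat.card_le_card_of_surjective _ Set.rangeFactorization_surjective

end DowlingLattice

/-! ### Extension by one index. -/

namespace DowlingLattice

/-- The inclusion of `{0} ∪ ([n] × G)` into `{0} ∪ ([n + 1] × G)`. -/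
def castPoint {G : Type*} {n : ℕ} : Option (Fin n × G) → Option (Fin (n + 1) × G) :=
  Option.map (Prod.map Fin.castSucc id)

/-- A point with index in `[n + 1]` either has index in `[n]` or lies over the last index. -/
theorem castPoint_cases {G : Type*} {n : ℕ} {P : Option (Fin (n + 1) × G) → Prop}
    (hc : ∀ p : Option (Fin n × G), P (castPoint p)) (hl : ∀ g, P (some (Fin.last n, g))) :
    ∀ p, P p := by
  rintro (_ | ⟨i, g⟩)
  · exact hc none
  · induction i using Fin.lastCases with
    | last => exact hl g
    | cast i => exact hc (some (i, g))

variable {G : Type*} [Group G] {n : ℕ}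

theorem castPoint_translate (h : G) (p : Option (Fin n × G)) :
    castPoint (dowlingTranslate h p) = dowlingTranslate h (castPoint p) := by
  rcases p with _ | ⟨i, g⟩ <;> rfl

/-- The map whose fibres are the classes of the extension of `x` by one index, where `(n + 1, 1)`
joins the class `c` if `o = some c`, and forms a new block if `o = none`. -/
def extendMap (x : DowlingLattice G n) (o : Option x.Class) :
    Option (Fin (n + 1) × G) → x.Class ⊕ G
  | none => Sum.inl (x.mk none)
  -- Equivariance forces `(n + 1, g)` into `g • c`; the summand `G` holds the translates of a new
  -- block. If `c` is the class of `0`, the index enters the zero block.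
  | some (i, g) =>
    Fin.lastCases (motive := fun _ => x.Class ⊕ G)
      (o.elim (Sum.inr g) fun c => Sum.inl (g • c)) (fun j => Sum.inl (x.mk (some (j, g)))) i

theorem extendMap_castPoint (x : DowlingLattice G n) (o : Option x.Class)
    (p : Option (Fin n × G)) : x.extendMap o (castPoint p) = Sum.inl (x.mk p) := by
  rcases p with _ | ⟨i, g⟩
  · rfl
  · simp [castPoint, extendMap]

theorem extendMap_none_last (x : DowlingLattice G n) (g : G) :
    x.extendMap none (some (Fin.last n, g)) = Sum.inr g := by
  simp [extendMap]

theorem extendMap_some_last (x : DowlingLattice G n) (c : x.Class) (g : G) :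
    x.extendMap (some c) (some (Fin.last n, g)) = Sum.inl (g • c) := by
  simp [extendMap]

theorem extendMap_translate (x : DowlingLattice G n) (o : Option x.Class) (h : G) :
    ∀ p, x.extendMap o (dowlingTranslate h p) = h • x.extendMap o p := by
  refine castPoint_cases (fun p => ?_) fun g => ?_
  · rw [← castPoint_translate, extendMap_castPoint, extendMap_castPoint]
    rfl
  · rw [dowlingTranslate_some]
    cases o with
    | none =>
      rw [extendMap_none_last, extendMap_none_last]
      rfl
    | some c =>
      rw [extendMap_some_last, extendMap_some_last, mul_smul]
      rfl

theorem extendMap_separates (x : DowlingLattice G n) (o : Option x.Class) (i : Fin (n + 1))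
    (g g' : G) (h : x.extendMap o (some (i, g)) = x.extendMap o (some (i, g'))) (hg : g ≠ g') :
    x.extendMap o (some (i, g)) = x.extendMap o none := by
  induction i using Fin.lastCases with
  | last =>
    cases o with
    | none =>
      rw [extendMap_none_last, extendMap_none_last] at h
      exact absurd (Sum.inr_injective h) hg
    | some c =>
      rw [extendMap_some_last, extendMap_some_last] at h
      rw [extendMap_some_last, x.eq_mk_none_of_smul_eq_smul (Sum.inl_injective h) hg]
      rfl
  | cast i =>
    have e : ∀ k : G, x.extendMap o (some (i.castSucc, k)) = Sum.inl (x.mk (some (i, k))) :=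
      fun k => x.extendMap_castPoint o (some (i, k))
    rw [e, e] at h
    rw [e, x.mk_eq_mk_none_of_ne (Sum.inl_injective h) hg]
    rfl

/-- The extension of `x` by one index: `(n + 1, 1)` joins the class `c` if `o = some c`, and forms
a new block if `o = none`. -/
def extend (x : DowlingLattice G n) (o : Option x.Class) : DowlingLattice G (n + 1) :=
  ofMap (x.extendMap o) (x.extendMap_translate o) (x.extendMap_separates o)

theorem extend_rel (x : DowlingLattice G n) (o : Option x.Class) (p q) :
    (x.extend o).1 p q ↔ x.extendMap o p = x.extendMap o q :=
  Iff.rfl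

theorem extend_rel_castPoint (x : DowlingLattice G n) (o : Option x.Class)
    (p q : Option (Fin n × G)) : (x.extend o).1 (castPoint p) (castPoint q) ↔ x.1 p q := by
  rw [extend_rel, extendMap_castPoint, extendMap_castPoint, Sum.inl.injEq, mk_eq_mk]

theorem extend_rel_last (x : DowlingLattice G n) (o : Option x.Class) (p : Option (Fin n × G)) :
    (x.extend o).1 (some (Fin.last n, 1)) (castPoint p) ↔ o = some (x.mk p) := by
  rw [extend_rel, extendMap_castPoint]
  cases o with
  | none => simp [extendMap_none_last]
  | some c => rw [extendMap_some_last, one_smul, Sum.inl.injEq, Option.some.injEq]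

theorem rel_last_iff (y : DowlingLattice G (n + 1)) (g : G) (p : Option (Fin n × G)) :
    y.1 (some (Fin.last n, g)) (castPoint p) ↔
      y.1 (some (Fin.last n, 1)) (castPoint (dowlingTranslate g⁻¹ p)) := by
  constructor
  · intro h
    have := y.rel_translate g⁻¹ h
    rwa [dowlingTranslate_some, inv_mul_cancel, ← castPoint_translate] at this
  · intro h
    have := y.rel_translate g h
    rwa [dowlingTranslate_some, mul_one, ← castPoint_translate, ← dowlingTranslate_mul,
      mul_inv_cancel, dowlingTranslate_one] at this

/-- An element is determined by its restriction and the points related to `(n + 1, 1)`. -/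
theorem ext_castPoint {y z : DowlingLattice G (n + 1)}
    (hc : ∀ p q, y.1 (castPoint p) (castPoint q) ↔ z.1 (castPoint p) (castPoint q))
    (hl : ∀ p, y.1 (some (Fin.last n, 1)) (castPoint p) ↔
      z.1 (some (Fin.last n, 1)) (castPoint p)) : y = z := by
  have hl' : ∀ g p, y.1 (some (Fin.last n, g)) (castPoint p) ↔
      z.1 (some (Fin.last n, g)) (castPoint p) := fun g p => by
    rw [rel_last_iff, rel_last_iff z, hl]
  have hll : ∀ {y z : DowlingLattice G (n + 1)},
      (∀ g p, y.1 (some (Fin.last n, g)) (castPoint p) ↔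
        z.1 (some (Fin.last n, g)) (castPoint p)) → ∀ g g',
      y.1 (some (Fin.last n, g)) (some (Fin.last n, g')) →
        z.1 (some (Fin.last n, g)) (some (Fin.last n, g')) := by
    intro y z H g g' h
    -- Distinct points over the same index can be related only through the zero block, which `H`
    -- with `p = none` detects.
    by_cases hg : g = g'
    · rw [hg]
    · have h0 := y.2.2 _ _ _ h hg
      have h0' := y.2.2 _ _ _ (y.1.symm h) (Ne.symm hg)
      exact z.1.trans ((H g none).1 h0) (z.1.symm ((H g' none).1 h0'))
  ext p q
  revert p q
  refine castPoint_cases (fun p => ?_) fun g => ?_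
  · refine castPoint_cases (fun q => hc p q) fun g => ?_
    exact y.1.comm'.trans ((hl' g p).trans z.1.comm')
  · exact castPoint_cases (fun q => hl' g q)
      fun g' => ⟨hll hl' g g', hll (fun g p => (hl' g p).symm) g g'⟩

/-- The restriction to the first `n` indices. -/
def restrict (y : DowlingLattice G (n + 1)) : DowlingLattice G n :=
  ⟨y.1.comap castPoint, fun h p q hpq => by
    rw [Setoid.comap_rel] at hpq ⊢
    rw [castPoint_translate, castPoint_translate]
    exact y.rel_translate h hpq, fun i g g' h hg => y.2.2 i.castSucc g g' h hg⟩

/-- The inverse restricts to the first `n` indices and records the class that `(n + 1, 1)` meets, if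
any. -/
theorem extend_bijective : Function.Bijective
    fun a : Σ x : DowlingLattice G n, Option x.Class => a.1.extend a.2 := by
  constructor
  · rintro ⟨x, o⟩ ⟨x', o'⟩ h
    obtain rfl : x = x' := by
      ext p q
      rw [← extend_rel_castPoint x o, ← extend_rel_castPoint x' o']
      exact Iff.of_eq (congrArg (fun y : DowlingLattice G (n + 1) =>
        y.1 (castPoint p) (castPoint q)) h)
    have key : ∀ p, o = some (x.mk p) ↔ o' = some (x.mk p) := fun p => by
      rw [← extend_rel_last, ← extend_rel_last]
      exact Iff.of_eq (congrArg (fun y : DowlingLattice G (n + 1) =>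
        y.1 (some (Fin.last n, 1)) (castPoint p)) h)
    obtain rfl : o = o' := by
      cases o with
      | none =>
        cases o' with
        | none => rfl
        | some c =>
          obtain ⟨p, rfl⟩ := Quotient.exists_rep c
          exact (key p).2 rfl
      | some c =>
        obtain ⟨p, rfl⟩ := Quotient.exists_rep c
        exact ((key p).1 rfl).symm
    rfl
  · intro y
    by_cases hy : ∃ p, y.1 (some (Fin.last n, 1)) (castPoint p)
    · obtain ⟨p, hp⟩ := hy
      refine ⟨⟨y.restrict, some (y.restrict.mk p)⟩, ext_castPoint (fun q q' => ?_) fun q => ?_⟩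
      · exact extend_rel_castPoint _ _ _ _
      · rw [extend_rel_last, Option.some.injEq, mk_eq_mk]
        exact ⟨fun h => y.1.trans hp h, fun h => y.1.trans (y.1.symm hp) h⟩
    · refine ⟨⟨y.restrict, none⟩, ext_castPoint (fun q q' => ?_) fun q => ?_⟩
      · exact extend_rel_castPoint _ _ _ _
      · rw [extend_rel_last]
        exact ⟨fun h => by simp at h, fun h => absurd ⟨q, h⟩ hy⟩

theorem numClasses_extend_some [Finite G] (x : DowlingLattice G n) (c : x.Class) :
    (x.extend (some c)).numClasses = x.numClasses := by
  have hr : Set.range (x.extendMap (some c)) = Set.range Sum.inl := by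
    apply Set.Subset.antisymm
    · rintro _ ⟨p, rfl⟩
      revert p
      refine castPoint_cases (fun p => ?_) fun g => ?_
      · rw [extendMap_castPoint]
        exact ⟨_, rfl⟩
      · rw [extendMap_some_last]
        exact ⟨_, rfl⟩
    · rintro _ ⟨q, rfl⟩
      obtain ⟨p, rfl⟩ := Quotient.exists_rep q
      exact ⟨castPoint p, x.extendMap_castPoint _ p⟩
  rw [extend, numClasses_ofMap, hr]
  exact Nat.card_range_of_injective Sum.inl_injective

theorem numClasses_extend_none [Finite G] (x : DowlingLattice G n) :
    (x.extend none).numClasses = x.numClasses + Nat.card G := by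
  have hr : Set.range (x.extendMap none) = Set.univ := by
    rw [Set.range_eq_univ]
    rintro (q | g)
    · obtain ⟨p, rfl⟩ := Quotient.exists_rep q
      exact ⟨castPoint p, x.extendMap_castPoint _ p⟩
    · exact ⟨_, x.extendMap_none_last g⟩
  rw [extend, numClasses_ofMap, hr, Nat.card_univ, Nat.card_sum, numClasses]

theorem numClasses_zero (x : DowlingLattice G 0) : x.numClasses = 1 := by
  refine Nat.card_eq_one_iff_exists.2 ⟨x.mk none, fun q => ?_⟩
  obtain ⟨p, rfl⟩ := Quotient.exists_rep q
  obtain _ | ⟨i, g⟩ := p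
  · rfl
  · exact i.elim0

instance : Unique (DowlingLattice G 0) where
  default := ⟨⊤, fun _ _ _ _ => trivial, fun _ _ _ _ _ => trivial⟩
  uniq x := by
    ext p q
    refine ⟨fun _ => trivial, fun _ => ?_⟩
    obtain _ | ⟨i, _⟩ := p
    · obtain _ | ⟨i, _⟩ := q
      · exact x.1.refl _
      · exact i.elim0
    · exact i.elim0

/-! ### Corank in terms of the number of classes. -/

variable [Finite G]

/-- Building an element index by index, each new block adds `|G|` classes to the initial zero class,
and joining adds none. -/
theorem exists_numClasses_eq : ∀ {n : ℕ} (x : DowlingLattice G n),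
    ∃ k, x.numClasses = 1 + Nat.card G * k
  | 0, x => ⟨0, x.numClasses_zero⟩
  | n + 1, y => by
    obtain ⟨⟨x, o⟩, rfl⟩ := extend_bijective.2 y
    obtain ⟨k, hk⟩ := exists_numClasses_eq x
    cases o with
    | none => exact ⟨k + 1, by rw [numClasses_extend_none, hk]; ring⟩
    | some c => exact ⟨k, by rw [numClasses_extend_some, hk]⟩

/-- Going up strictly lowers `k`, and absorbing one block lowers it by exactly one. -/
theorem coheight_eq_of_numClasses {k : ℕ} {x : DowlingLattice G n}
    (hx : x.numClasses = 1 + Nat.card G * k) : Order.coheight x = k := by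
  have hm : 0 < Nat.card G := Nat.card_pos
  induction k using Nat.strong_induction_on generalizing x with
  | _ k ih =>
  have hlt : ∀ y > x, ∃ l < k, y.numClasses = 1 + Nat.card G * l := by
    intro y hy
    obtain ⟨l, hl⟩ := y.exists_numClasses_eq
    refine ⟨l, ?_, hl⟩
    have := numClasses_lt_of_lt hy
    rw [hl, hx] at this
    exact lt_of_mul_lt_mul_left (Nat.lt_of_add_lt_add_left this) hm.le
  have hlt' : ∀ y > x, Order.coheight y < k := by
    intro y hy
    obtain ⟨l, hl, h⟩ := hlt y hy
    rw [ih l hl h]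
    exact_mod_cast hl
  refine Order.coheight_eq_coe_iff.2 ⟨?_, ?_, hlt'⟩
  · exact lt_of_le_of_lt (Order.coheight_le_coe_iff.2 hlt') (ENat.natCast_lt_top k)
  · obtain rfl | hk := Nat.eq_zero_or_pos k
    · exact Or.inl rfl
    right
    obtain ⟨y, hxy, hy⟩ := x.exists_gt_numClasses_le (by rw [hx]; have := Nat.mul_pos hm hk; omega)
    obtain ⟨l, hl, h⟩ := hlt y hxy
    refine ⟨y, hxy, ?_⟩
    -- The class count drops by at most `|G|`, so `k` drops by at most one.
    have hkl : k ≤ l + 1 := by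
      rw [hx, h] at hy
      refine le_of_mul_le_mul_left ?_ hm
      rw [mul_add, mul_one]
      omega
    obtain rfl : k = l + 1 := by omega
    rw [ih l hl h]
    push_cast
    exact_mod_cast (Nat.add_sub_cancel (n := l) (m := 1)).symm

theorem coheight_eq_iff {k : ℕ} {x : DowlingLattice G n} :
    Order.coheight x = k ↔ x.numClasses = 1 + Nat.card G * k := by
  refine ⟨fun h => ?_, coheight_eq_of_numClasses⟩
  obtain ⟨l, hl⟩ := x.exists_numClasses_eq
  rw [coheight_eq_of_numClasses hl] at h
  rw [hl, Nat.cast_injective h]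

end DowlingLattice

/-! ### Recurrence for the Whitney numbers and conclusion. -/

section Whitney

open DowlingLattice

variable (G : Type*) [Group G] [Finite G]

theorem dowlingWhitney_eq_card (n k : ℕ) : dowlingWhitney G n k =
    Nat.card {x : DowlingLattice G n // x.numClasses = 1 + Nat.card G * k} :=
  Nat.card_congr (Equiv.subtypeEquivRight fun _ => coheight_eq_iff)

theorem dowlingWhitney_zero_zero : dowlingWhitney G 0 0 = 1 := by
  rw [dowlingWhitney_eq_card]
  simp [numClasses_zero]

theorem dowlingWhitney_zero_succ (k : ℕ) : dowlingWhitney G 0 (k + 1) = 0 := by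
  rw [dowlingWhitney_eq_card]
  have := (Nat.card_pos (α := G)).ne'
  simp [numClasses_zero, this]

/-- The elements of `Q_{n + 1}(G)` with a given number of classes, sorted by whether the last
index forms a block of its own or joins a class of the restriction. -/
theorem card_numClasses_succ (n N : ℕ) :
    Nat.card {y : DowlingLattice G (n + 1) // y.numClasses = N} =
      Nat.card {x : DowlingLattice G n // x.numClasses + Nat.card G = N} +
        N * Nat.card {x : DowlingLattice G n // x.numClasses = N} := by
  classical
  let e : {y : DowlingLattice G (n + 1) // y.numClasses = N} ≃
      {a : Σ x : DowlingLattice G n, Option x.Class // (a.1.extend a.2).numClasses = N} :=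
    ((Equiv.ofBijective _ extend_bijective).subtypeEquiv fun _ => Iff.rfl).symm
  let f : {x : DowlingLattice G n // x.numClasses + Nat.card G = N} ⊕
      (Σ x : {x : DowlingLattice G n // x.numClasses = N}, x.1.Class) →
      {a : Σ x : DowlingLattice G n, Option x.Class // (a.1.extend a.2).numClasses = N} :=
    Sum.elim (fun x => ⟨⟨x.1, none⟩, (x.1.numClasses_extend_none).trans x.2⟩)
      fun a => ⟨⟨a.1.1, some a.2⟩, (a.1.1.numClasses_extend_some a.2).trans a.1.2⟩
  have hf : Function.Bijective f := by
    constructor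
    · rintro (⟨x, hx⟩ | ⟨⟨x, hx⟩, c⟩) (⟨x', hx'⟩ | ⟨⟨x', hx'⟩, c'⟩) h
      · have := congrArg (fun a => a.1.1) h
        change x = x' at this
        subst this
        rfl
      · have := congrArg (fun a => a.1.2.isSome) h
        simp [f] at this
      · have := congrArg (fun a => a.1.2.isSome) h
        simp [f] at this
      · simp only [f, Sum.elim_inr, Subtype.mk.injEq, Sigma.mk.injEq] at h
        obtain ⟨rfl, h⟩ := h
        obtain rfl := Option.some_injective _ (eq_of_heq h)
        rfl
    · rintro ⟨⟨x, _ | c⟩, hx⟩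
      · exact ⟨Sum.inl ⟨x, (x.numClasses_extend_none).symm.trans hx⟩, rfl⟩
      · exact ⟨Sum.inr ⟨⟨x, (x.numClasses_extend_some c).symm.trans hx⟩, c⟩, rfl⟩
  -- The factor `N` counts the classes that the last index may join.
  have : Fintype {x : DowlingLattice G n // x.numClasses = N} := Fintype.ofFinite _
  rw [Nat.card_congr e, ← Nat.card_eq_of_bijective f hf, Nat.card_sum, Nat.card_sigma,
    Finset.sum_congr rfl fun x _ => show Nat.card x.1.Class = N from x.2]
  simp [mul_comm]

theorem dowlingWhitney_succ_zero (n : ℕ) : dowlingWhitney G (n + 1) 0 = dowlingWhitney G n 0 := by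
  rw [dowlingWhitney_eq_card, card_numClasses_succ, dowlingWhitney_eq_card]
  -- A new block would give at least `1 + |G|` classes, whereas corank `0` means a single class.
  have : IsEmpty {x : DowlingLattice G n // x.numClasses + Nat.card G = 1 + Nat.card G * 0} :=
    ⟨fun x => by
      have h1 := x.1.numClasses_pos
      have h2 := Nat.card_pos (α := G)
      have h3 := x.2
      omega⟩
  rw [Nat.card_of_isEmpty]
  ring

theorem dowlingWhitney_succ_succ (n k : ℕ) : dowlingWhitney G (n + 1) (k + 1) =
    (1 + Nat.card G * (k + 1)) * dowlingWhitney G n (k + 1) + dowlingWhitney G n k := by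
  rw [dowlingWhitney_eq_card, card_numClasses_succ, dowlingWhitney_eq_card,
    dowlingWhitney_eq_card, add_comm]
  congr 1
  refine Nat.card_congr (Equiv.subtypeEquivRight fun x => ?_)
  rw [mul_add, mul_one, ← add_assoc, Nat.add_right_cancel_iff]

/-- If `w (k + 1) = (c + d (k + 1)) w k`, then the numbers `w k * W_m(n, k)` form an affine
triangle. -/
theorem isAffineTriangle_dowlingWhitney {c d : ℝ} (hc : 0 ≤ c) (hd : 0 ≤ d) (hcd : 0 < c + d)
    {w : ℕ → ℝ} (hw0 : w 0 = 1) (hw : ∀ k, w (k + 1) = (c + d * (k + 1)) * w k) :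
    IsAffineTriangle 1 (Nat.card G) c d fun n k => w k * dowlingWhitney G n k where
  a_pos := one_pos
  b_nonneg := Nat.cast_nonneg _
  c_nonneg := hc
  d_nonneg := hd
  cd_pos := hcd
  zero_zero := by simp [hw0, dowlingWhitney_zero_zero]
  zero_succ k := by simp [dowlingWhitney_zero_succ]
  succ_zero n := by simp [dowlingWhitney_succ_zero]
  succ_succ n k := by
    rw [dowlingWhitney_succ_succ, hw]
    push_cast
    ring

theorem stronglyQLogConvex_dowlingWhitney {c d : ℝ} (hc : 0 ≤ c) (hd : 0 ≤ d) (hcd : 0 < c + d)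
    {w : ℕ → ℝ} (hw0 : w 0 = 1) (hw : ∀ k, w (k + 1) = (c + d * (k + 1)) * w k) :
    StronglyQLogConvex fun n =>
      ∑ k ∈ Finset.range (n + 1), C (w k * dowlingWhitney G n k) * X ^ k := by
  have h := isAffineTriangle_dowlingWhitney G hc hd hcd hw0 hw
  refine h.stronglyQLogConvex fun n k => ?_
  simp only [finsetSum_coeff, coeff_C_mul_X_pow, Finset.sum_ite_eq, Finset.mem_range]
  split_ifs with hk
  · rfl
  · exact (h.eq_zero_of_lt (by omega)).symm

end Whitney

theorem corollary3p4 (G : Type*) [Group G] [Finite G] :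
    StronglyQLogConvex (fun n => dowlingPoly G n) ∧
    StronglyQLogConvex (fun n => dowlingF₁ G n) ∧
    StronglyQLogConvex (fun n => dowlingF₂ G n) := by
  have hm : (0 : ℝ) < Nat.card G := Nat.cast_pos.2 Nat.card_pos
  refine ⟨?_, ?_, ?_⟩
  -- The weights `1`, `k! m^k` and `k!` have ratios `w (k+1) / w k` equal to `1`, `m (k+1)` and `k +
  -- 1`, which dictate `c` and `d`.
  · have := stronglyQLogConvex_dowlingWhitney G (c := 1) (d := 0) (w := fun _ => 1)
      zero_le_one le_rfl (by norm_num) rfl (by simp)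
    simpa only [dowlingPoly, one_mul] using this
  · have := stronglyQLogConvex_dowlingWhitney G (c := 0) (d := Nat.card G)
      (w := fun k => k.factorial * (Nat.card G : ℝ) ^ k) le_rfl hm.le (by rwa [zero_add])
      (by simp) (fun k => by rw [Nat.factorial_succ]; push_cast; ring)
    simpa only [dowlingF₁, mul_right_comm] using this
  · exact stronglyQLogConvex_dowlingWhitney G (c := 0) (d := 1) (w := fun k => k.factorial)
      le_rfl zero_le_one (by norm_num) (by simp)
      (fun k => by rw [Nat.factorial_succ]; push_cast; ring)
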